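/- A group structure on a metric space $(X,d)$ is called compatible if all left translations $x\mapsto gx$, all right translations $x\mapsto xg$ and the inversion $x\mapsto x^{-1}$ are isometries of $(X,d)$. A metric space $(X,d)$ is called natural if it carries a compatible group structure and any two compatible group structures on $X$ are isomorphic. A group $G$ is called natural if there is a metric $d$ on the set $G$ such that $(G,d)$ is a natural metric space and the given group structure of $G$ is compatible with $d$. For a group $Q$ let $\mathbb{Z}_2\wr Q=\left(\bigoplus_{k\in Q}\mathbb{Z}_2\right)\rtimes Q$ be the restricted regular wreath product, where $\mathbb{Z}_2=\mathbb{Z}/2\mathbb{Z}$ and $Q$ acts on the lamp configurations $\bigoplus_{k\in Q}\mathbb{Z}_2$ by left translation of the index $k$. Let $D_\infty=\langle a,b\mid a^2=b^2=1\rangle$ be the infinite dihedral group. Then the lamplighter group $\mathbb{Z}_2\wr\mathbb{Z}$ is not natural, while the limping (dihedral) lamplighter group $\mathbb{Z}_2\wr D_\infty$ is natural. -/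

import Mathlib

/-- The group structure on the metric space `X` is compatible with the metric: all left translations,
all right translations and the inversion are isometries. -/
structure IsMetricGroup (X : Type*) [MetricSpace X] [Group X] : Prop where
  isometry_mul_left : ∀ g : X, Isometry (fun x : X => g * x)
  isometry_mul_right : ∀ g : X, Isometry (fun x : X => x * g)
  isometry_inv : Isometry (fun x : X => x⁻¹)

/-- The two group structures `G₁` and `G₂` on the set `X` are isomorphic. -/
def AreIsomorphicGroupStructures {X : Type*} (G₁ G₂ : Group X) : Prop :=
  ∃ e : X ≃ X, ∀ x y : X, e (G₁.mul x y) = G₂.mul (e x) (e y)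

/-- A metric space is natural if it carries a compatible group structure, and any two compatible
group structures on it are isomorphic. -/
def IsNaturalMetricSpace (X : Type*) [MetricSpace X] : Prop :=
  (∃ G : Group X, @IsMetricGroup X _ G) ∧
    ∀ G₁ G₂ : Group X, @IsMetricGroup X _ G₁ → @IsMetricGroup X _ G₂ →
      AreIsomorphicGroupStructures G₁ G₂

/-- A group is natural if its underlying set carries a metric that makes it a natural metric space
and with which the group structure is compatible. -/
def IsNaturalGroup (G : Type*) [Group G] : Prop :=
  ∃ d : MetricSpace G, @IsMetricGroup G d _ ∧ @IsNaturalMetricSpace G d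

/-- The action of `Q` on the lamp configurations `⨁_{k ∈ Q} ℤ/2` (written multiplicatively) by
left translation of the lamps: the lamp at `k` moves to `q * k`. -/
noncomputable def lampShift (Q : Type*) [Group Q] : Q →* MulAut (Multiplicative (Q →₀ ZMod 2)) where
  toFun q := AddEquiv.toMultiplicative (Finsupp.domCongr (Equiv.mulLeft q))
  map_one' := by
    ext f k
    simp
    rfl
  map_mul' p q := by
    ext f k
    simp
    rfl

/-- The restricted regular wreath product `ℤ/2 ≀ Q = (⨁_{k ∈ Q} ℤ/2) ⋊ Q`. -/
abbrev LampWreath (Q : Type*) [Group Q] : Type _ :=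
  Multiplicative (Q →₀ ZMod 2) ⋊[lampShift Q] Q

/-- The lamplighter group `ℤ/2 ≀ ℤ`. -/
abbrev LamplighterGroup : Type := LampWreath (Multiplicative ℤ)

/-- The limping (dihedral) lamplighter group `ℤ/2 ≀ D_∞`; Mathlib's `DihedralGroup 0` is the infinite
dihedral group `D_∞`. -/
abbrev LimpingLamplighterGroup : Type := LampWreath (DihedralGroup 0)

open SemidirectProduct

/-! Conjugating `x⁻¹ * y` by the base part of `x` leaves the plain lamp difference together with
`y.right * x.right⁻¹` (`isConj_coords`), and an invariant distance depends only on this pair. Over a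
commutative base the direct product structure respects the pair up to swapping `x` and `y`, so it is
compatible too; it is abelian, the wreath product is not.

Over `D_∞`, take a metric that separates all conjugacy classes up to inversion
(`exists_generic_metric`). In any compatible structure `H`, multiplying `x` by a lamp configuration
on either side shifts that configuration by an element of `D_∞` (`exists_mul_lamp`), always `1` or
always the base coordinate of `x` (`mul_lamp_dichotomy`). If both sides agreed, the base coordinate
of a product, computed in two ways, would make `D_∞` commutative. So `H` is an extension of `D_∞` by
the lamps with the translation action, and it splits because `D_∞` is a free product of two groups
of order two whose generators lift to involutions. -/

theorem lamp_add_self {Q : Type*} (a : Q →₀ ZMod 2) : a + a = 0 := by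
  ext; simp [CharTwo.add_self_eq_zero]

theorem lamp_neg {Q : Type*} (a : Q →₀ ZMod 2) : -a = a := by
  ext; simp [ZMod.neg_eq_self_mod_two]

/-! ### Translation of lamp configurations -/

section Shift

variable {Q : Type*} [Group Q]

/-- The left translation of lamp configurations by `q`. -/
noncomputable def shift (q : Q) : (Q →₀ ZMod 2) ≃+ (Q →₀ ZMod 2) :=
  Finsupp.domCongr (Equiv.mulLeft q)

@[simp]
theorem shift_apply (q : Q) (a : Q →₀ ZMod 2) (k : Q) : shift q a k = a (q⁻¹ * k) := by
  simp [shift, Finsupp.domCongr, Finsupp.equivMapDomain_apply]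

@[simp]
theorem shift_single (q k : Q) (c : ZMod 2) :
    shift q (Finsupp.single k c) = Finsupp.single (q * k) c := by
  simp [shift, Finsupp.domCongr, Finsupp.equivMapDomain_single]

@[simp]
theorem shift_one (a : Q →₀ ZMod 2) : shift 1 a = a := by
  ext; simp

theorem shift_mul (p q : Q) (a : Q →₀ ZMod 2) : shift (p * q) a = shift p (shift q a) := by
  ext; simp [mul_assoc]

@[simp]
theorem shift_shift_inv (q : Q) (a : Q →₀ ZMod 2) : shift q (shift q⁻¹ a) = a := by
  rw [← shift_mul]; simp

theorem card_support_shift (q : Q) (a : Q →₀ ZMod 2) :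
    (shift q a).support.card = a.support.card := by
  simp [shift, Finsupp.domCongr, Finsupp.equivMapDomain]

theorem lampShift_apply (q : Q) (f : Multiplicative (Q →₀ ZMod 2)) :
    lampShift Q q f = Multiplicative.ofAdd (shift q f.toAdd) := rfl

theorem shift_eq_of_single {p q : Q} (k : Q)
    (h : shift p (Finsupp.single k (1 : ZMod 2)) = shift q (Finsupp.single k 1)) : p = q := by
  rw [shift_single, shift_single, Finsupp.single_left_inj one_ne_zero] at h
  exact mul_right_cancel h

end Shift

/-! ### Commutative base: the direct product is also compatible -/

theorem isConj_coords {Q : Type*} [Group Q] (x y : LampWreath Q) :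
    IsConj (x⁻¹ * y) ⟨x.left⁻¹ * y.left, y.right * x.right⁻¹⟩ := by
  refine isConj_iff.2 ⟨inr x.right, ?_⟩
  ext1
  · simp only [mul_left, mul_right, left_inr, right_inr, inv_left, inv_right, one_mul,
      ← MulAut.mul_apply, ← map_mul]
    simp
  · simp

theorem dist_eq_dist_one_coords {Q : Type*} [Group Q] [MetricSpace (LampWreath Q)]
    (h : IsMetricGroup (LampWreath Q)) (x y : LampWreath Q) :
    dist x y = dist (1 : LampWreath Q) ⟨x.left⁻¹ * y.left, y.right * x.right⁻¹⟩ := by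
  obtain ⟨c, hc⟩ := isConj_iff.1 (isConj_coords x y)
  rw [← hc, ← (h.isometry_mul_left (c * x⁻¹)).dist_eq x y,
    ← (h.isometry_mul_right c⁻¹).dist_eq (c * x⁻¹ * x) (c * x⁻¹ * y)]
  simp [mul_assoc]

/-- Every metric compatible with the lamplighter group is compatible with the direct product
structure on its underlying set. -/
theorem isMetricGroup_prod {Q : Type*} [CommGroup Q] [d : MetricSpace (LampWreath Q)]
    (h : IsMetricGroup (LampWreath Q)) :
    @IsMetricGroup (LampWreath Q) d (equivProd (φ := lampShift Q)).group := by
  have inv_lamp : ∀ f : Multiplicative (Q →₀ ZMod 2), f⁻¹ = f := fun f => lamp_neg f.toAdd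
  refine @IsMetricGroup.mk _ d (equivProd (φ := lampShift Q)).group ?_ ?_ ?_
  · intro g
    refine Isometry.of_dist_eq fun x y => ?_
    change dist (⟨g.left * x.left, g.right * x.right⟩ : LampWreath Q)
      ⟨g.left * y.left, g.right * y.right⟩ = _
    rw [dist_eq_dist_one_coords h, dist_eq_dist_one_coords h x y]
    congr 2
    · simp [mul_assoc]
    · rw [mul_inv, mul_mul_mul_comm]; simp
  · intro g
    refine Isometry.of_dist_eq fun x y => ?_
    change dist (⟨x.left * g.left, x.right * g.right⟩ : LampWreath Q)
      ⟨y.left * g.left, y.right * g.right⟩ = _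
    rw [dist_eq_dist_one_coords h, dist_eq_dist_one_coords h x y]
    congr 2
    · rw [mul_inv, mul_mul_mul_comm]; simp
    · simp
  · refine Isometry.of_dist_eq fun x y => ?_
    change dist (⟨x.left⁻¹, x.right⁻¹⟩ : LampWreath Q) ⟨y.left⁻¹, y.right⁻¹⟩ = _
    -- Lamps are their own inverses, while the base difference is reversed; exchanging `x` and `y`
    -- absorbs this.
    rw [dist_comm x y, dist_eq_dist_one_coords h, dist_eq_dist_one_coords h y x]
    congr 2
    · simp [inv_lamp, mul_comm]
    · simp [mul_comm]

theorem not_isNaturalGroup_lampWreath (Q : Type*) [CommGroup Q] [Nontrivial Q] :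
    ¬ IsNaturalGroup (LampWreath Q) := by
  rintro ⟨d, hd, -, hnat⟩
  obtain ⟨e, he⟩ := hnat _ _ hd (isMetricGroup_prod hd)
  have comm : ∀ x y : LampWreath Q, x * y = y * x := by
    intro x y
    apply e.injective
    refine (he x y).trans (Eq.trans ?_ (he y x).symm)
    exact congrArg (equivProd (φ := lampShift Q)).symm (mul_comm _ _)
  obtain ⟨q, hq⟩ := exists_ne (1 : Q)
  have h := congrArg left (comm (inr q) (inl (Multiplicative.ofAdd (Finsupp.single 1 1))))
  simp only [mul_left, left_inr, right_inr, left_inl, right_inl, one_mul, map_one, mul_one,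
    lampShift_apply, toAdd_ofAdd] at h
  exact hq (shift_eq_of_single (p := q) (q := 1) 1
    (by rw [shift_one]; exact Multiplicative.ofAdd.injective h))

/-! ### A metric separating classes up to inversion -/

theorem isConj_inv {G : Type*} [Group G] {a b : G} (h : IsConj a b) : IsConj a⁻¹ b⁻¹ := by
  obtain ⟨c, rfl⟩ := isConj_iff.1 h
  exact isConj_iff.2 ⟨c, by group⟩

/-- There are countably many classes, so they can receive distinct lengths `1 + 1/(n+1)`; lengths in
`[1, 2]` make the triangle inequality automatic. -/
theorem exists_generic_metric (G : Type*) [Group G] [Countable G] :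
    ∃ d : MetricSpace G, @IsMetricGroup G d _ ∧ ∀ x y x' y' : G, d.dist x y = d.dist x' y' →
      IsConj (x⁻¹ * y) (x'⁻¹ * y') ∨ IsConj (x⁻¹ * y)⁻¹ (x'⁻¹ * y') := by
  classical
  let S : Setoid G :=
    { r := fun a b => IsConj a b ∨ IsConj a⁻¹ b
      iseqv :=
        { refl := fun a => Or.inl (IsConj.refl a)
          symm := by
            rintro a b (h | h)
            · exact Or.inl h.symm
            · exact Or.inr (by simpa only [inv_inv] using isConj_inv h.symm)
          trans := by
            rintro a b c (h | h) (k | k)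
            · exact Or.inl (h.trans k)
            · exact Or.inr ((isConj_inv h).trans k)
            · exact Or.inr (h.trans k)
            · exact Or.inl (by simpa only [inv_inv] using (isConj_inv h).trans k) } }
  obtain ⟨f, hf⟩ := exists_injective_nat (Quotient S)
  let ℓ : G → ℝ := fun g => 1 + 1 / ((f (Quotient.mk S g) : ℝ) + 1)
  have ℓ_eq : ∀ g g', ℓ g = ℓ g' ↔ (IsConj g g' ∨ IsConj g⁻¹ g') := by
    intro g g'
    have : ℓ g = ℓ g' ↔ f (Quotient.mk S g) = f (Quotient.mk S g') := by
      simp only [ℓ, one_div, add_right_inj, inv_inj, add_left_inj, Nat.cast_inj]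
    rw [this, hf.eq_iff]
    exact Quotient.eq
  have ℓ_ge : ∀ g, 1 ≤ ℓ g := fun g => by
    have : 0 ≤ 1 / ((f (Quotient.mk S g) : ℝ) + 1) := by positivity
    simp only [ℓ]; linarith
  have ℓ_le : ∀ g, ℓ g ≤ 2 := fun g => by
    have : 1 / ((f (Quotient.mk S g) : ℝ) + 1) ≤ 1 := by
      rw [div_le_one (by positivity)]; linarith [Nat.cast_nonneg (α := ℝ) (f (Quotient.mk S g))]
    simp only [ℓ]; linarith
  let D : G → G → ℝ := fun x y => if x = y then 0 else ℓ (x⁻¹ * y)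
  have D_eq : ∀ x y x' y' : G,
      (IsConj (x⁻¹ * y) (x'⁻¹ * y') ∨ IsConj (x⁻¹ * y)⁻¹ (x'⁻¹ * y')) → D x y = D x' y' := by
    intro x y x' y' h
    have : x = y ↔ x' = y' := by
      rw [← inv_mul_eq_one, ← inv_mul_eq_one (a := x')]
      constructor
      · intro e; simpa only [e, inv_one, isConj_one_right, or_self] using h
      · intro e; simpa only [e, isConj_one_left, inv_eq_one, or_self] using h
    simp only [D]
    by_cases hxy : x = y
    · rw [if_pos hxy, if_pos (this.1 hxy)]
    · rw [if_neg hxy, if_neg (mt this.2 hxy), (ℓ_eq _ _).2 h]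
  let d : MetricSpace G :=
    { dist := D
      dist_self := fun x => if_pos rfl
      dist_comm := fun x y => D_eq _ _ _ _
        (Or.inr (by rw [mul_inv_rev, inv_inv]))
      dist_triangle := by
        intro x y z
        simp only [D]
        have h1 := ℓ_ge (x⁻¹ * y)
        have h2 := ℓ_ge (y⁻¹ * z)
        have h3 := ℓ_le (x⁻¹ * z)
        by_cases hxy : x = y
        · subst hxy; simp
        · by_cases hyz : y = z
          · subst hyz; simp
          · rw [if_neg hxy, if_neg hyz]
            split_ifs <;> linarith
      eq_of_dist_eq_zero := by
        intro x y h
        by_contra hxy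
        have h' : D x y = 0 := h
        simp only [D, if_neg hxy] at h'
        linarith [ℓ_ge (x⁻¹ * y)] }
  refine ⟨d, @IsMetricGroup.mk G d _ ?_ ?_ ?_, ?_⟩
  · refine fun g => Isometry.of_dist_eq fun x y => D_eq _ _ _ _ (Or.inl ?_)
    rw [mul_inv_rev, mul_assoc, inv_mul_cancel_left]
  · refine fun g => Isometry.of_dist_eq fun x y => D_eq _ _ _ _ (Or.inl ?_)
    exact isConj_iff.2 ⟨g, by group⟩
  · refine Isometry.of_dist_eq fun x y => D_eq _ _ _ _ (Or.inr ?_)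
    exact isConj_iff.2 ⟨x⁻¹, by group⟩
  · intro x y x' y' h
    change D x y = D x' y' at h
    simp only [D] at h
    by_cases hxy : x = y <;> by_cases hxy' : x' = y'
    · subst hxy hxy'; simp
    · rw [if_pos hxy, if_neg hxy'] at h; linarith [ℓ_ge (x'⁻¹ * y')]
    · rw [if_neg hxy, if_pos hxy'] at h; linarith [ℓ_ge (x⁻¹ * y)]
    · rw [if_neg hxy, if_neg hxy'] at h; exact (ℓ_eq _ _).1 h

/-! ### Conjugacy up to inversion in coordinates -/

/-- The relation between the coordinates `(w, h)` and `(w', h')` of two elements of `ℤ/2 ≀ Q` that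
holds when they are conjugate up to inversion. -/
def LampRel {Q : Type*} [Group Q] (w : Q →₀ ZMod 2) (h : Q) (w' : Q →₀ ZMod 2) (h' : Q) : Prop :=
  ∃ k b, (h' = k * h * k⁻¹ ∨ h' = k * h⁻¹ * k⁻¹) ∧ w' = shift k w + (b + shift h' b)

section Rel

variable {Q : Type*} [Group Q]

theorem LampRel.of_one {w w' : Q →₀ ZMod 2} {h' : Q} (h : LampRel w 1 w' h') :
    h' = 1 ∧ ∃ k, w' = shift k w := by
  obtain ⟨k, b, h1, h2⟩ := h
  have : h' = 1 := by simpa using h1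
  subst this
  exact ⟨rfl, k, by simpa [lamp_add_self] using h2⟩

theorem lampRel_of_isConj {x y x' y' : LampWreath Q}
    (h : IsConj (x⁻¹ * y) (x'⁻¹ * y') ∨ IsConj (x⁻¹ * y)⁻¹ (x'⁻¹ * y')) :
    LampRel (x.left.toAdd + y.left.toAdd) (y.right * x.right⁻¹)
      (x'.left.toAdd + y'.left.toAdd) (y'.right * x'.right⁻¹) := by
  have neg : ∀ u v : LampWreath Q, u.left.toAdd + v.left.toAdd = (u.left⁻¹ * v.left).toAdd := by
    intro u v
    rw [toAdd_mul, toAdd_inv, lamp_neg]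
  have h' : IsConj (⟨x.left⁻¹ * y.left, y.right * x.right⁻¹⟩ : LampWreath Q)
        ⟨x'.left⁻¹ * y'.left, y'.right * x'.right⁻¹⟩ ∨
      IsConj (⟨x.left⁻¹ * y.left, y.right * x.right⁻¹⟩ : LampWreath Q)⁻¹
        ⟨x'.left⁻¹ * y'.left, y'.right * x'.right⁻¹⟩ := by
    rcases h with h | h
    · exact Or.inl (((isConj_coords x y).symm.trans h).trans (isConj_coords x' y'))
    · exact Or.inr (((isConj_inv (isConj_coords x y)).symm.trans h).trans (isConj_coords x' y'))
  rw [neg, neg]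
  generalize x.left⁻¹ * y.left = w, y.right * x.right⁻¹ = p, x'.left⁻¹ * y'.left = w',
    y'.right * x'.right⁻¹ = p' at h'
  rcases h' with h' | h' <;> obtain ⟨⟨b, k⟩, hb⟩ := isConj_iff.1 h'
  · have h1 := congrArg left hb
    have h2 := congrArg right hb
    simp only [mul_right, inv_right, mul_left, inv_left] at h1 h2
    refine ⟨k, b.toAdd, Or.inl h2.symm, ?_⟩
    subst h2 h1
    simp only [lampShift_apply, toAdd_mul, toAdd_ofAdd, toAdd_inv, lamp_neg, ← shift_mul]
    abel
  · have h1 := congrArg left hb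
    have h2 := congrArg right hb
    simp only [mul_right, inv_right, mul_left, inv_left] at h1 h2
    refine ⟨k * p⁻¹, b.toAdd, Or.inr ?_, ?_⟩
    · rw [← h2]; group
    subst h2 h1
    simp only [lampShift_apply, toAdd_mul, toAdd_ofAdd, toAdd_inv, lamp_neg, ← shift_mul]
    abel

/-- The parity `φ` of the lamps lit on the coset `⟨h⟩l` is invariant under the shift by `h`, hence
vanishes on `b + shift h b`. -/
theorem mul_inv_mem_zpowers_of_single {k l h : Q} {b : Q →₀ ZMod 2}
    (e : Finsupp.single k 1 + Finsupp.single l 1 = b + shift h b) :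
    k * l⁻¹ ∈ Subgroup.zpowers h := by
  classical
  let φ : (Q →₀ ZMod 2) →+ ZMod 2 := Finsupp.liftAddHom fun g =>
    if g * l⁻¹ ∈ Subgroup.zpowers h then AddMonoidHom.id _ else 0
  have hφ : ∀ g, φ (Finsupp.single g 1) = if g * l⁻¹ ∈ Subgroup.zpowers h then 1 else 0 := by
    intro g
    simp only [φ, Finsupp.liftAddHom_apply_single]
    split_ifs <;> rfl
  have inv : φ.comp (shift h).toAddMonoidHom = φ := by
    refine Finsupp.addHom_ext fun g c => ?_
    have : h * g * l⁻¹ ∈ Subgroup.zpowers h ↔ g * l⁻¹ ∈ Subgroup.zpowers h := by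
      rw [mul_assoc]
      exact Subgroup.mul_mem_cancel_left _ (Subgroup.mem_zpowers h)
    simp [φ, this]
  have h1 := congrArg φ e
  rw [map_add, map_add, show φ (shift h b) = φ b from DFunLike.congr_fun inv b,
    CharTwo.add_self_eq_zero, hφ, hφ] at h1
  by_contra hk
  simp [hk] at h1

theorem card_support_add_single_of_eq_zero {Q : Type*} {a : Q →₀ ZMod 2} {g : Q} (h : a g = 0) :
    (a + Finsupp.single g 1).support.card = a.support.card + 1 := by
  classical
  have hs : (Finsupp.single g (1 : ZMod 2)).support = {g} :=
    by simp [Finsupp.support_single]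
  have hd : Disjoint a.support (Finsupp.single g (1 : ZMod 2)).support := by
    rw [hs]; simpa using h
  rw [Finsupp.support_add_eq hd, Finset.card_union_of_disjoint hd, hs, Finset.card_singleton]

theorem card_support_add_single_of_ne_zero {Q : Type*} {a : Q →₀ ZMod 2} {g : Q} (h : a g ≠ 0) :
    (a + Finsupp.single g 1).support.card + 1 = a.support.card := by
  have h1 : a g = 1 := Fin.eq_one_of_ne_zero _ h
  have h2 : (a + Finsupp.single g 1 : Q →₀ ZMod 2) g = 0 := by simp [h1, CharTwo.add_self_eq_zero]
  rw [← card_support_add_single_of_eq_zero h2, add_assoc, lamp_add_self, add_zero]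

theorem lamp_eq_of_support {Q : Type*} {a b : Q →₀ ZMod 2} (h : a.support = b.support) : a = b := by
  ext g
  have h1 : a g = 0 ↔ b g = 0 := by
    rw [← Finsupp.notMem_support_iff, h, Finsupp.notMem_support_iff]
  generalize a g = u, b g = v at h1
  revert u v
  decide

/-- For `g` far away, `p * g` and `q * g` avoid the support of `w`; if distinct, they would add two
lit lamps, but a shift keeps the count. -/
theorem eq_of_single_eq_shift {Q : Type*} [Group Q] [Infinite Q] {p q : Q} {w : Q →₀ ZMod 2}
    (h : ∀ g, ∃ k, w + (shift p (Finsupp.single g 1) + shift q (Finsupp.single g 1)) = shift k w) :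
    p = q := by
  classical
  by_contra hpq
  obtain ⟨g, hg⟩ := Infinite.exists_notMem_finset
    (w.support.image (p⁻¹ * ·) ∪ w.support.image (q⁻¹ * ·))
  simp only [Finset.mem_union, Finset.mem_image, not_or, not_exists, not_and] at hg
  have h1 : w (p * g) = 0 := by
    by_contra h0
    exact hg.1 (p * g) (Finsupp.mem_support_iff.2 h0) (by simp)
  have h2 : w (q * g) = 0 := by
    by_contra h0
    exact hg.2 (q * g) (Finsupp.mem_support_iff.2 h0) (by simp)
  obtain ⟨k, hk⟩ := h g
  have h3 : (w + Finsupp.single (p * g) 1 : Q →₀ ZMod 2) (q * g) = 0 := by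
    simp [h2, hpq]
  have := congrArg (fun a : Q →₀ ZMod 2 => a.support.card) hk
  simp only [shift_single, ← add_assoc] at this
  rw [card_support_add_single_of_eq_zero h3, card_support_add_single_of_eq_zero h1,
    card_support_shift] at this
  omega

end Rel

/-! ### Rigidity of the infinite dihedral group -/

section Dihedral

open DihedralGroup

theorem mem_zpowers_sr {x : DihedralGroup 0} {i : ZMod 0} (h : x ∈ Subgroup.zpowers (sr i)) :
    x = 1 ∨ x = sr i := by
  obtain ⟨n, rfl⟩ := h
  have h2 : (sr i) ^ (2 : ℤ) = 1 := by
    rw [zpow_two, sr_mul_self]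
  obtain ⟨m, rfl | rfl⟩ := Int.even_or_odd' n
  · left; simp only [zpow_mul, h2, one_zpow]
  · right; simp only [zpow_add, zpow_mul, h2, one_zpow, zpow_one, one_mul]

theorem mem_zpowers_r {x : DihedralGroup 0} {i : ZMod 0} (h : x ∈ Subgroup.zpowers (r i)) :
    ∃ j, x = r j := by
  obtain ⟨n, rfl⟩ := h
  exact ⟨_, r_zpow i n⟩

theorem eq_mul_of_sr_right {σ : DihedralGroup 0 → DihedralGroup 0}
    (h : ∀ x i, σ (x * sr i) = σ x * sr i) (g : DihedralGroup 0) : σ g = σ 1 * g := by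
  rcases g with i | i
  · have : r i = 1 * sr 0 * sr i := by simp
    rw [this, h, h]; simp only [one_mul, mul_assoc]
  · rw [← h, one_mul]

theorem eq_mul_of_sr_left {σ : DihedralGroup 0 → DihedralGroup 0}
    (h : ∀ x i, σ (sr i * x) = sr i * σ x) (g : DihedralGroup 0) : σ g = g * σ 1 := by
  rcases g with i | i
  · have : r i = sr 0 * (sr i * 1) := by simp
    rw [this, h, h]; simp only [mul_one, mul_assoc]
  · rw [← h, mul_one]

theorem dihedral_conj_sr (q : DihedralGroup 0) (j : ZMod 0) : ∃ i, q * sr j * q⁻¹ = sr i := by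
  rcases q with k | k
  · exact ⟨_, rfl⟩
  · exact ⟨_, rfl⟩

/-- The value at `sr 0` decides. A rotation over `sr 0` is a reflection, generating only two
elements, which fixes `f` on rotations; a reflection over `sr 0` is a rotation, which excludes the
other option on reflections. -/
theorem eq_one_or_eq_self_of_zpowers {f : DihedralGroup 0 → DihedralGroup 0} (h1 : f 1 = 1)
    (h : ∀ q q', f q' * (f q)⁻¹ ∈ Subgroup.zpowers (q' * q⁻¹)) :
    (∀ q, f q = 1) ∨ ∀ q, f q = q := by
  have hs : ∀ i, f (sr i) = 1 ∨ f (sr i) = sr i := fun i => by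
    have := h 1 (sr i)
    rw [h1, inv_one, mul_one, mul_one] at this
    exact mem_zpowers_sr this
  have hr : ∀ i, ∃ j, f (r i) = r j := fun i => by
    have := h 1 (r i)
    rw [h1, inv_one, mul_one, mul_one] at this
    exact mem_zpowers_r this
  have hss : ∀ i, ∃ j, f (sr i) * (f (sr 0))⁻¹ = r j := fun i => mem_zpowers_r (h (sr 0) (sr i))
  have hrs : ∀ i, f (r i) * (f (sr 0))⁻¹ = 1 ∨ f (r i) * (f (sr 0))⁻¹ = sr (0 - i) := fun i =>
    mem_zpowers_sr (h (sr 0) (r i))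
  rcases hs 0 with h0 | h0
  · left
    rintro (i | i)
    · have := hrs i
      obtain ⟨j, hj⟩ := hr i
      rw [h0, hj, inv_one, mul_one] at this
      rw [hj]
      exact this.resolve_right nofun
    · obtain ⟨j, hj⟩ := hss i
      rw [h0, inv_one, mul_one] at hj
      refine (hs i).resolve_right ?_
      rw [hj]; simp
  · right
    rintro (i | i)
    · have := hrs i
      obtain ⟨j, hj⟩ := hr i
      rw [h0, hj, inv_sr, r_mul_sr] at this
      rw [hj]
      have := this.resolve_left nofun
      simpa using this
    · obtain ⟨j, hj⟩ := hss i
      rw [h0, inv_sr] at hj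
      refine (hs i).resolve_left ?_
      intro h2
      rw [h2, one_mul] at hj
      simp at hj

/-- A self-map of the lamp configurations over `D_∞` that fixes `0` and preserves differences up to
translation is a translation. -/
theorem exists_eq_shift {f : (DihedralGroup 0 →₀ ZMod 2) → (DihedralGroup 0 →₀ ZMod 2)}
    (h0 : f 0 = 0) (h : ∀ a b, ∃ k, f a + f b = shift k (a + b)) : ∃ k, ∀ a, f a = shift k a := by
  have h' : ∀ a, ∃ k, f a = shift k a := fun a => by simpa [h0] using h a 0
  have hs : ∀ g, ∃ g', f (Finsupp.single g 1) = Finsupp.single g' 1 := fun g => by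
    obtain ⟨k, hk⟩ := h' (Finsupp.single g 1)
    exact ⟨_, by rw [hk, shift_single]⟩
  choose σ hσ using hs
  -- The pair `{x, x * sr i}` goes to a translate of itself. Right multiplication by the involution
  -- swaps its points, so both matchings give the same equation.
  have hσr : ∀ x i, σ (x * sr i) = σ x * sr i := by
    intro x i
    obtain ⟨k, hk⟩ := h (Finsupp.single x 1) (Finsupp.single (x * sr i) 1)
    rw [hσ, hσ, map_add, shift_single, shift_single] at hk
    have hne : k * x ≠ k * (x * sr i) := by
      rw [← mul_assoc]
      intro e
      exact absurd (left_eq_mul.1 e) nofun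
    have e1 := DFunLike.congr_fun hk (k * x)
    have e2 := DFunLike.congr_fun hk (k * (x * sr i))
    simp only [Finsupp.add_apply, Finsupp.single_apply, hne, hne.symm, if_true, if_false,
      add_zero, zero_add] at e1 e2
    have e3 : sr i * sr i = (1 : DihedralGroup 0) := sr_mul_self i
    by_cases c1 : σ x = k * x
    · have c2 : σ (x * sr i) = k * (x * sr i) := by
        by_contra c2
        simp [c1, c2, hne] at e2
      rw [c1, c2, mul_assoc]
    · have c2 : σ (x * sr i) = k * x := by
        by_contra c2
        simp [c1, c2] at e1
      have c3 : σ x = k * (x * sr i) := by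
        by_contra c3
        simp [c3, c2, hne] at e2
      rw [c2, c3, mul_assoc, mul_assoc, e3, mul_one]
  have hσ' := eq_mul_of_sr_right hσr
  have card : ∀ a, (f a).support.card = a.support.card := fun a => by
    obtain ⟨k, hk⟩ := h' a
    rw [hk, card_support_shift]
  refine ⟨σ 1, fun a => (lamp_eq_of_support (Finset.eq_of_subset_of_card_le ?_ ?_)).symm⟩
  · intro g hg
    rw [Finsupp.mem_support_iff, shift_apply] at hg
    rw [Finsupp.mem_support_iff]
    intro hfg
    -- Toggling this lamp would lower the number of lit lamps of `a` but raise that of `f a`.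
    obtain ⟨k, hk⟩ := h a (Finsupp.single ((σ 1)⁻¹ * g) 1)
    rw [hσ, hσ', mul_inv_cancel_left] at hk
    have c := congrArg (fun a : DihedralGroup 0 →₀ ZMod 2 => a.support.card) hk
    have c1 := card_support_add_single_of_eq_zero hfg
    have c2 := card_support_add_single_of_ne_zero hg
    simp only [card_support_shift, c1, card] at c
    omega
  · rw [card, card_support_shift]

end Dihedral

/-! ### Splitting extensions of the dihedral group -/

section Splitting

open DihedralGroup

variable {H : Type*} [Group H]

/-- The homomorphism from `D_∞` determined by two involutions. -/
def dihedralLift (s t : H) (hs : s * s = 1) (ht : t * t = 1) : DihedralGroup 0 →* H where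
  toFun
    | r i => (s * t) ^ (show ℤ from i)
    | sr i => s * (s * t) ^ (show ℤ from i)
  map_one' := zpow_zero _
  map_mul' := by
    have hsi : s⁻¹ = s := inv_eq_of_mul_eq_one_left hs
    have hti : t⁻¹ = t := inv_eq_of_mul_eq_one_left ht
    have comm : ∀ n : ℤ, (s * t) ^ n * s = s * (s * t) ^ (-n) := by
      intro n
      have : (s * t)⁻¹ = s * (s * t) * s⁻¹ := by
        rw [mul_inv_rev, hsi, hti, ← mul_assoc, hs, one_mul]
      rw [zpow_neg, ← inv_zpow, this, conj_zpow, hsi, mul_assoc, ← mul_assoc s, hs, one_mul]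
    rintro (i | i) (j | j)
    · exact zpow_add _ _ _
    · change s * (s * t) ^ ((show ℤ from j) - (show ℤ from i)) = _ * (s * _)
      rw [← mul_assoc, comm, mul_assoc, ← zpow_add, neg_add_eq_sub]
    · change s * (s * t) ^ ((show ℤ from i) + (show ℤ from j)) = s * _ * _
      rw [mul_assoc, ← zpow_add]
    · change (s * t) ^ ((show ℤ from j) - (show ℤ from i)) = s * _ * (s * _)
      rw [mul_assoc, ← mul_assoc _ s, comm, mul_assoc, ← zpow_add, ← mul_assoc, hs, one_mul,
        neg_add_eq_sub]

/-- A reflection exchanges rotations and reflections, so the part of `u` on the rotations serves as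
`v`. -/
theorem exists_add_shift_eq {i : ZMod 0} {u : DihedralGroup 0 →₀ ZMod 2} (h : shift (sr i) u = u) :
    ∃ v, v + shift (sr i) v = u := by
  classical
  refine ⟨u.filter fun g => ∃ j, g = r j, ?_⟩
  ext g
  have hg := DFunLike.congr_fun h g
  rw [shift_apply] at hg
  clear h
  rcases g with j | j <;> simp_all

/-- An extension of `D_∞` by its lamp configurations with the translation action is the limping
lamplighter group. -/
theorem nonempty_mulEquiv_of_extension (ι : Multiplicative (DihedralGroup 0 →₀ ZMod 2) →* H)
    (π : H →* DihedralGroup 0) (hι : Function.Injective ι) (hπ : Function.Surjective π)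
    (hπι : ∀ a, π (ι a) = 1) (hker : ∀ x, π x = 1 → ∃ a, ι a = x)
    (hconj : ∀ x a, x * ι a = ι (lampShift _ (π x) a) * x) :
    Nonempty (H ≃* LimpingLamplighterGroup) := by
  -- For a lift `t` of `sr i`, the lamps `u = t * t` commute with `t`, so `u = v + shift (sr i) v`
  -- and `v` corrects `t` to an involution.
  have invol : ∀ i, ∃ t, π t = sr i ∧ t * t = 1 := by
    intro i
    obtain ⟨t, ht⟩ := hπ (sr i)
    obtain ⟨u, hu⟩ := hker (t * t) (by rw [map_mul, ht, sr_mul_self])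
    have h1 : lampShift _ (sr i) u = u := by
      apply hι
      have := hconj t u
      rw [ht, hu, ← mul_assoc] at this
      rw [hu]
      exact (mul_right_cancel this).symm
    obtain ⟨v, hv⟩ := exists_add_shift_eq (u := u.toAdd) h1
    refine ⟨ι (Multiplicative.ofAdd v) * t, by rw [map_mul, hπι, one_mul, ht], ?_⟩
    rw [mul_assoc, ← mul_assoc t, hconj, ht, mul_assoc, ← hu, ← map_mul, ← map_mul]
    have : Multiplicative.ofAdd v * (lampShift _ (sr i) (Multiplicative.ofAdd v) * u) = 1 := by
      rw [← mul_assoc]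
      change v + shift (sr i) v + u.toAdd = 0
      rw [hv, lamp_add_self]
    rw [this, map_one]
  obtain ⟨s, hs, hss⟩ := invol 0
  obtain ⟨t, ht, htt⟩ := invol 1
  let S := dihedralLift s t hss htt
  have hπS : ∀ g, π (S g) = g := by
    rintro (i | i)
    · change π ((s * t) ^ (show ℤ from i)) = r i
      rw [map_zpow, map_mul, hs, ht, sr_mul_sr, r_zpow, sub_zero, one_mul]
      exact congrArg r Int.cast_id
    · change π (s * (s * t) ^ (show ℤ from i)) = sr i
      rw [map_mul, map_zpow, map_mul, hs, ht, sr_mul_sr, r_zpow, sr_mul_r, sub_zero, one_mul,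
        zero_add]
      exact congrArg sr Int.cast_id
  let F : LimpingLamplighterGroup →* H := SemidirectProduct.lift ι S fun g => by
    refine MonoidHom.ext fun a => ?_
    change ι (lampShift _ g a) = S g * ι a * (S g)⁻¹
    rw [hconj, hπS, mul_inv_cancel_right]
  have hF : ∀ a g, F ⟨a, g⟩ = ι a * S g := fun a g => rfl
  refine ⟨(MulEquiv.ofBijective F ⟨(injective_iff_map_eq_one F).2 ?_, ?_⟩).symm⟩
  · rintro ⟨a, g⟩ h
    rw [hF] at h
    have hg : g = 1 := by
      have := congrArg π h
      rwa [map_mul, hπι, hπS, one_mul, map_one] at this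
    subst hg
    rw [map_one, mul_one, map_eq_one_iff ι hι] at h
    subst h
    rfl
  · intro x
    obtain ⟨a, ha⟩ := hker (x * (S (π x))⁻¹) (by rw [map_mul, map_inv, hπS, mul_inv_cancel])
    exact ⟨⟨a, π x⟩, by rw [hF, ha, inv_mul_cancel_right]⟩

end Splitting

/-! ### Compatible structures in coordinates -/

/-- Coordinates on a group `H` identifying it with `ℤ/2 ≀ Q` in such a way that the translations of
`H` preserve the conjugacy classes up to inversion of the differences in `ℤ/2 ≀ Q`. -/
structure LampChart {Q H : Type*} [Group Q] [Group H] (e : H ≃ (Q →₀ ZMod 2) × Q) : Prop where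
  one : e 1 = (0, 1)
  left : ∀ z x y, LampRel ((e x).1 + (e y).1) ((e y).2 * (e x).2⁻¹)
    ((e (z * x)).1 + (e (z * y)).1) ((e (z * y)).2 * (e (z * x)).2⁻¹)
  right : ∀ z x y, LampRel ((e x).1 + (e y).1) ((e y).2 * (e x).2⁻¹)
    ((e (x * z)).1 + (e (y * z)).1) ((e (y * z)).2 * (e (x * z)).2⁻¹)

namespace LampChart

theorem op {Q H : Type*} [Group Q] [Group H] {e : H ≃ (Q →₀ ZMod 2) × Q} (he : LampChart e) :
    LampChart (MulOpposite.opEquiv.symm.trans e) where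
  one := he.one
  left z x y := he.right z.unop x.unop y.unop
  right z x y := he.left z.unop x.unop y.unop

open DihedralGroup

variable {H : Type*} [Group H] {e : H ≃ (DihedralGroup 0 →₀ ZMod 2) × DihedralGroup 0}

theorem exists_mul_lamp (he : LampChart e) :
    ∃ l : H → DihedralGroup 0, ∀ x a,
      e (x * e.symm (a, 1)) = ((e x).1 + shift (l x) a, (e x).2) := by
  have key : ∀ x : H, ∃ k, ∀ a, e (x * e.symm (a, 1)) = ((e x).1 + shift k a, (e x).2) := by
    intro x
    have h2 : ∀ a, (e (x * e.symm (a, 1))).2 = (e x).2 := by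
      intro a
      have := he.left x 1 (e.symm (a, 1))
      rw [Equiv.apply_symm_apply, he.one, mul_one, inv_one, mul_one] at this
      exact mul_inv_eq_one.1 this.of_one.1
    have one : e.symm (0, 1) = 1 := by rw [← he.one, Equiv.symm_apply_apply]
    obtain ⟨k, hk⟩ := exists_eq_shift (f := fun a => (e x).1 + (e (x * e.symm (a, 1))).1)
      (by simp only [one, mul_one, lamp_add_self]) (by
        intro a b
        have := he.left x (e.symm (a, 1)) (e.symm (b, 1))
        rw [Equiv.apply_symm_apply, Equiv.apply_symm_apply, inv_one, mul_one] at this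
        obtain ⟨k, hk⟩ := this.of_one.2
        refine ⟨k, ?_⟩
        rw [← hk, add_add_add_comm, lamp_add_self, zero_add])
    refine ⟨k, fun a => Prod.ext ?_ (h2 a)⟩
    rw [← hk, ← add_assoc, lamp_add_self, zero_add]
  choose l hl using key
  exact ⟨l, hl⟩

theorem mul_lamp_dichotomy (he : LampChart e) {l : H → DihedralGroup 0}
    (hl : ∀ x a, e (x * e.symm (a, 1)) = ((e x).1 + shift (l x) a, (e x).2)) :
    (∀ x, l x = 1) ∨ ∀ x, l x = (e x).2 := by
  have congr : ∀ x x', (e x).2 = (e x').2 → l x = l x' := by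
    intro x x' h
    refine eq_of_single_eq_shift (w := (e x).1 + (e x').1) fun g => ?_
    have := he.right (e.symm (Finsupp.single g 1, 1)) x x'
    rw [hl, hl, h, mul_inv_cancel] at this
    obtain ⟨k, hk⟩ := this.of_one.2
    exact ⟨k, by rw [← hk, add_add_add_comm]⟩
  let f : DihedralGroup 0 → DihedralGroup 0 := fun q => l (e.symm (0, q))
  have hf : ∀ x, l x = f (e x).2 := fun x => congr _ _ (by simp)
  have f1 : f 1 = 1 := by
    have one : e.symm (0, 1) = 1 := by rw [← he.one, Equiv.symm_apply_apply]
    have := hl 1 (Finsupp.single 1 1)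
    rw [one_mul, Equiv.apply_symm_apply, he.one, zero_add] at this
    have h1 := congrArg Prod.fst this
    simp only [f, one]
    exact (shift_eq_of_single 1 (by rw [shift_one]; exact h1)).symm
  have := eq_one_or_eq_self_of_zpowers f1 fun q q' => by
    obtain ⟨k, b, h1, h2⟩ := he.right (e.symm (Finsupp.single 1 1, 1))
      (e.symm (0, q)) (e.symm (0, q'))
    simp only [hl, Equiv.apply_symm_apply, add_zero, map_zero, zero_add, shift_single, mul_one]
      at h1 h2
    rw [add_comm (Finsupp.single _ _)] at h2
    exact mul_inv_mem_zpowers_of_single h2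
  rcases this with h | h
  · exact Or.inl fun x => by rw [hf, h]
  · exact Or.inr fun x => by rw [hf, h]

/-- Adding the two relations puts `α` in `⟨h'⟩k'`, where `k'` conjugates `sr i` to `h'`; powers of
`h'` do not affect this. Inversion plays no role since `sr i` is an involution. -/
theorem eq_conj_of_lampRel {i : ZMod 0} {F : DihedralGroup 0 →₀ ZMod 2} {α h' : DihedralGroup 0}
    (h0 : LampRel 0 (sr i) F h')
    (h1 : LampRel (Finsupp.single 1 1) (sr i) (F + Finsupp.single α 1) h') :
    h' = α * sr i * α⁻¹ := by
  obtain ⟨k, b, -, hb⟩ := h0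
  obtain ⟨k', b', hk', hb'⟩ := h1
  have hk' : h' = k' * sr i * k'⁻¹ := by simpa using hk'
  rw [map_zero, zero_add] at hb
  rw [shift_single, mul_one] at hb'
  have : Finsupp.single α 1 + Finsupp.single k' 1 = (b + b') + shift h' (b + b') := by
    have e1 : Finsupp.single α (1 : ZMod 2) = F + (F + Finsupp.single α 1) := by
      rw [← add_assoc, lamp_add_self, zero_add]
    rw [e1, hb']
    nth_rewrite 1 [hb]
    rw [map_add]
    have := lamp_add_self (Finsupp.single k' (1 : ZMod 2))
    calc b + shift h' b + (Finsupp.single k' 1 + (b' + shift h' b')) + Finsupp.single k' 1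
        = b + b' + (shift h' b + shift h' b') + (Finsupp.single k' 1 + Finsupp.single k' 1) := by
          abel
      _ = _ := by rw [this, add_zero]
  obtain ⟨n, hn⟩ := mul_inv_mem_zpowers_of_single this
  have hn : α = h' ^ n * k' := by
    have hn : h' ^ n = α * k'⁻¹ := hn
    rw [hn, inv_mul_cancel_right]
  have : h' ^ n * k' * sr i * (h' ^ n * k')⁻¹ = h' ^ n * (k' * sr i * k'⁻¹) * (h' ^ n)⁻¹ := by
    simp only [mul_inv_rev, mul_assoc]
  rw [hn, this, ← hk', ((Commute.refl h').zpow_left n).eq, mul_inv_cancel_right]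

theorem snd_mul_of_one (he : LampChart e)
    (hl : ∀ x a, e (x * e.symm (a, 1)) = ((e x).1 + a, (e x).2)) (z : H) (q : DihedralGroup 0) :
    (e (z * e.symm (0, q))).2 = q * (e z).2 := by
  have one : e.symm (0, 1) = 1 := by rw [← he.one, Equiv.symm_apply_apply]
  have hz : ∀ c q, e (z * e.symm (c, q)) =
      ((e (z * e.symm (0, q))).1 + c, (e (z * e.symm (0, q))).2) := by
    intro c q
    have : e.symm (c, q) = e.symm (0, q) * e.symm (c, 1) := by
      rw [Equiv.symm_apply_eq, hl, Equiv.apply_symm_apply, zero_add]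
    rw [this, ← mul_assoc, hl]
  have := eq_mul_of_sr_left (σ := fun q => (e (z * e.symm (0, q))).2) (fun x i => ?_) q
  · rw [this, one, mul_one]
  -- One extra lamp at `1` reappears at `1` in the image, so `eq_conj_of_lampRel` applies with `α =
  -- 1`.
  · have h0 := he.left z (e.symm (0, x)) (e.symm (0, sr i * x))
    have h1 := he.left z (e.symm (0, x)) (e.symm (Finsupp.single 1 1, sr i * x))
    rw [hz (Finsupp.single 1 1), ← add_assoc] at h1
    simp only [Equiv.apply_symm_apply, mul_inv_cancel_right, add_zero, zero_add] at h0 h1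
    have := eq_conj_of_lampRel h0 h1
    rw [one_mul, inv_one, mul_one] at this
    exact mul_inv_eq_iff_eq_mul.1 this

theorem snd_mul_of_self (he : LampChart e)
    (hl : ∀ x a, e (x * e.symm (a, 1)) = ((e x).1 + shift (e x).2 a, (e x).2))
    (z : H) (q : DihedralGroup 0) : (e (z * e.symm (0, q))).2 = (e z).2 * q := by
  have one : e.symm (0, 1) = 1 := by rw [← he.one, Equiv.symm_apply_apply]
  have hz : ∀ c q, e (z * e.symm (c, q)) =
      ((e (z * e.symm (0, q))).1 + shift ((e (z * e.symm (0, q))).2 * q⁻¹) c,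
        (e (z * e.symm (0, q))).2) := by
    intro c q
    have : e.symm (c, q) = e.symm (0, q) * e.symm (shift q⁻¹ c, 1) := by
      rw [Equiv.symm_apply_eq, hl, Equiv.apply_symm_apply, zero_add, shift_shift_inv]
    rw [this, ← mul_assoc, hl, shift_mul]
  have := eq_mul_of_sr_right (σ := fun q => (e (z * e.symm (0, q))).2) (fun x j => ?_) q
  · rw [this, one, mul_one]
  · obtain ⟨i, hi⟩ := dihedral_conj_sr x j
    have h0 := he.left z (e.symm (0, x)) (e.symm (0, x * sr j))
    have h1 := he.left z (e.symm (0, x)) (e.symm (Finsupp.single 1 1, x * sr j))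
    rw [hz (Finsupp.single 1 1), ← add_assoc] at h1
    simp only [Equiv.apply_symm_apply, add_zero, zero_add, hi, shift_single, mul_one] at h0 h1
    have := eq_conj_of_lampRel h0 h1
    rw [← hi] at this
    change (e (z * e.symm (0, x * sr j))).2 = (e (z * e.symm (0, x))).2 * sr j
    generalize (e (z * e.symm (0, x * sr j))).2 = m', (e (z * e.symm (0, x))).2 = m at this ⊢
    have h2 : m⁻¹ = sr j * m'⁻¹ := by
      have : m' * m⁻¹ = m' * (sr j * m'⁻¹) := by
        rw [this]
        simp only [mul_inv_rev, inv_inv, mul_assoc, inv_mul_cancel_left]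
      exact mul_left_cancel this
    have h3 : m = m' * sr j := by
      rw [← inv_inv m, h2, mul_inv_rev, inv_inv, inv_sr]
    rw [h3, mul_assoc, sr_mul_self, mul_one]

theorem nonempty_mulEquiv (he : LampChart e) : Nonempty (H ≃* LimpingLamplighterGroup) := by
  obtain ⟨l, hl⟩ := he.exists_mul_lamp
  obtain ⟨ρ', hρ'⟩ := he.op.exists_mul_lamp
  let ρ : H → DihedralGroup 0 := fun x => ρ' (.op x)
  have hρ : ∀ x a, e (e.symm (a, 1) * x) = ((e x).1 + shift (ρ x) a, (e x).2) :=
    fun x a => hρ' (.op x) a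
  have dl := he.mul_lamp_dichotomy hl
  have dρ : (∀ x, ρ x = 1) ∨ ∀ x, ρ x = (e x).2 :=
    (he.op.mul_lamp_dichotomy hρ').imp (fun h x => h (.op x)) (fun h x => h (.op x))
  have one : e.symm (0, 1) = 1 := by rw [← he.one, Equiv.symm_apply_apply]
  have noncomm : ¬ ∀ p q : DihedralGroup 0, p * q = q * p := by
    intro h
    have := h (r 1) (sr 0)
    rw [r_mul_sr, sr_mul_r, sr.injEq] at this
    exact absurd this (by decide)
  -- Conjugation by `x` shifts lamps by `θ x`: move `a` across `x` by matching the shifts `l x` and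
  -- `ρ x`.
  let θ : H → DihedralGroup 0 := fun x => (ρ x)⁻¹ * l x
  have hθ : (∀ x, θ x = (e x).2) ∨ ∀ x, θ x = (e x).2⁻¹ := by
    rcases dl with dl | dl <;> rcases dρ with dρ | dρ
    · exfalso
      apply noncomm
      intro p q
      have h1 := he.snd_mul_of_one (fun x a => by rw [hl, dl, shift_one]) (e.symm (0, q)) p
      have h2 := he.op.snd_mul_of_one (fun x a => by
        rw [hρ', show ρ' x = 1 from dρ x.unop, shift_one]) (.op (e.symm (0, p))) q
      rw [Equiv.apply_symm_apply] at h1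
      change (e (e.symm (0, q) * e.symm (0, p))).2 = q * (e (e.symm (0, p))).2 at h2
      rw [Equiv.apply_symm_apply] at h2
      rw [← h1, h2]
    · right; intro x; simp only [θ, dl, dρ, mul_one]
    · left; intro x; simp only [θ, dl, dρ, inv_one, one_mul]
    · exfalso
      apply noncomm
      intro p q
      have h1 := he.snd_mul_of_self (fun x a => by rw [hl, dl]) (e.symm (0, q)) p
      have h2 := he.op.snd_mul_of_self (fun x a => by
        rw [hρ', show ρ' x = _ from dρ x.unop]; rfl) (.op (e.symm (0, p))) q
      rw [Equiv.apply_symm_apply] at h1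
      change (e (e.symm (0, q) * e.symm (0, p))).2 = (e (e.symm (0, p))).2 * q at h2
      rw [Equiv.apply_symm_apply] at h2
      rw [← h2, h1]
  have hl1 : ∀ a, l (e.symm (a, 1)) = 1 := fun a => by
    rcases dl with dl | dl <;> rw [dl]
    rw [Equiv.apply_symm_apply]
  let ι : Multiplicative (DihedralGroup 0 →₀ ZMod 2) →* H :=
    { toFun := fun a => e.symm (a.toAdd, 1)
      map_one' := one
      map_mul' := fun a b => by
        rw [Equiv.symm_apply_eq, hl, hl1, shift_one, Equiv.apply_symm_apply]
        rfl }
  have hιa : ∀ a, ι a = e.symm (a.toAdd, 1) := fun _ => rfl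
  have hι : Function.Injective ι := fun a b h => by
    have := congrArg Prod.fst (e.symm.injective h)
    exact this
  have hconj : ∀ x a, x * ι a = ι (lampShift _ (θ x) a) * x := by
    intro x a
    apply e.injective
    rw [hιa, hιa, hl, hρ, lampShift_apply, toAdd_ofAdd, ← shift_mul]
    simp only [θ, mul_inv_cancel_left]
  -- Multiplicativity comes from faithfulness: a single lamp detects the shift.
  let π : H →* DihedralGroup 0 := MonoidHom.mk' θ fun x y => by
    have h1 := hconj (x * y) (.ofAdd (Finsupp.single 1 1))
    rw [mul_assoc, hconj y, ← mul_assoc, hconj x, mul_assoc] at h1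
    have h2 := hι (mul_right_cancel h1)
    rw [lampShift_apply, lampShift_apply, lampShift_apply, toAdd_ofAdd, toAdd_ofAdd,
      ← shift_mul] at h2
    exact (shift_eq_of_single 1 (Multiplicative.ofAdd.injective h2)).symm
  have hθ1 : ∀ x, θ x = 1 ↔ (e x).2 = 1 := fun x => by
    rcases hθ with h | h <;> rw [h]
    exact inv_eq_one
  refine nonempty_mulEquiv_of_extension ι π hι ?_ ?_ ?_ hconj
  · intro q
    rcases hθ with h | h
    · exact ⟨e.symm (0, q), (h _).trans (by rw [Equiv.apply_symm_apply])⟩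
    · exact ⟨e.symm (0, q⁻¹), (h _).trans (by rw [Equiv.apply_symm_apply, inv_inv])⟩
  · intro a
    exact (hθ1 _).2 (by rw [hιa, Equiv.apply_symm_apply])
  · intro x hx
    refine ⟨.ofAdd (e x).1, ?_⟩
    rw [hιa, toAdd_ofAdd, Equiv.symm_apply_eq]
    exact Prod.ext rfl ((hθ1 x).1 hx).symm

end LampChart

/-! ### Naturality of the limping lamplighter group -/

/-- A group in bijection with the limping lamplighter group such that its translations on both sides
preserve differences up to conjugation and inversion is isomorphic to it. -/
theorem exists_equiv_limping {H : Type*} [Group H] (f : H ≃ LimpingLamplighterGroup)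
    (hleft : ∀ z x y, IsConj ((f x)⁻¹ * f y) ((f (z * x))⁻¹ * f (z * y)) ∨
      IsConj ((f x)⁻¹ * f y)⁻¹ ((f (z * x))⁻¹ * f (z * y)))
    (hright : ∀ z x y, IsConj ((f x)⁻¹ * f y) ((f (x * z))⁻¹ * f (y * z)) ∨
      IsConj ((f x)⁻¹ * f y)⁻¹ ((f (x * z))⁻¹ * f (y * z))) :
    ∃ e : H ≃ LimpingLamplighterGroup, ∀ x y, e (x * y) = e x * e y := by
  -- Left translation normalises `f` to preserve `1` without changing differences.
  let f' : H ≃ LimpingLamplighterGroup := f.trans (Equiv.mulLeft (f 1)⁻¹)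
  have hf' : ∀ x y, (f' x)⁻¹ * f' y = (f x)⁻¹ * f y := fun x y => by
    simp only [f', Equiv.trans_apply, Equiv.coe_mulLeft, mul_inv_rev, inv_inv, mul_assoc,
      mul_inv_cancel_left]
  have h1 : f' 1 = 1 := inv_mul_cancel (f 1)
  let e : H ≃ (DihedralGroup 0 →₀ ZMod 2) × DihedralGroup 0 :=
    (f'.trans equivProd).trans (Equiv.prodCongr Multiplicative.toAdd (Equiv.refl _))
  have he : LampChart e :=
    { one := by
        change ((f' 1).left.toAdd, (f' 1).right) = _
        rw [h1]; rfl
      left := fun z x y => lampRel_of_isConj (x := f' x) (y := f' y) (x' := f' (z * x))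
        (y' := f' (z * y)) (by rw [hf', hf']; exact hleft z x y)
      right := fun z x y => lampRel_of_isConj (x := f' x) (y := f' y) (x' := f' (x * z))
        (y' := f' (y * z)) (by rw [hf', hf']; exact hright z x y) }
  obtain ⟨F⟩ := he.nonempty_mulEquiv
  exact ⟨F.toEquiv, F.map_mul⟩

theorem isNaturalGroup_limping : IsNaturalGroup LimpingLamplighterGroup := by
  have : Countable (DihedralGroup 0) :=
    (DihedralGroup.equivSum (n := 0)).injective.countable (β := ℤ ⊕ ℤ)
  have : Countable LimpingLamplighterGroup :=
    (equivProd (φ := lampShift (DihedralGroup 0))).injective.countable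
      (β := (DihedralGroup 0 →₀ ZMod 2) × DihedralGroup 0)
  obtain ⟨d, hd, hgen⟩ := exists_generic_metric LimpingLamplighterGroup
  have iso : ∀ G₁ : Group LimpingLamplighterGroup, @IsMetricGroup _ d G₁ →
      ∃ e : LimpingLamplighterGroup ≃ LimpingLamplighterGroup,
        ∀ x y, e (G₁.mul x y) = e x * e y := by
    intro G₁ h₁
    exact @exists_equiv_limping LimpingLamplighterGroup G₁ (Equiv.refl _)
      (fun z x y => hgen _ _ _ _ ((@IsMetricGroup.isometry_mul_left _ d G₁ h₁ z).dist_eq x y).symm)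
      (fun z x y => hgen _ _ _ _ ((@IsMetricGroup.isometry_mul_right _ d G₁ h₁ z).dist_eq x y).symm)
  refine ⟨d, hd, ⟨_, hd⟩, fun G₁ G₂ h₁ h₂ => ?_⟩
  obtain ⟨e₁, he₁⟩ := iso G₁ h₁
  obtain ⟨e₂, he₂⟩ := iso G₂ h₂
  refine ⟨e₁.trans e₂.symm, fun x y => e₂.injective ?_⟩
  rw [he₂]
  simp [he₁]

theorem mainTheorem9 :
    ¬ IsNaturalGroup LamplighterGroup ∧ IsNaturalGroup LimpingLamplighterGroup := by
  exact ⟨not_isNaturalGroup_lampWreath _, isNaturalGroup_limping⟩
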